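/- Let $\lambda_{\rm b},\lambda_{\rm p}>0$ and $\bar m\ge 0$. Let the users form a Poisson cluster process $\Phi_{\rm u}=\bigcup_{\mathbf z\in\Phi_{\rm p}}(\mathbf z+\mathcal B^{\mathbf z})$ in $\mathbb R^2$, where $\Phi_{\rm p}$ is a homogeneous Poisson point process of intensity $\lambda_{\rm p}$ and, independently for each parent and independently of $\Phi_{\rm p}$, $\mathcal B^{\mathbf z}$ consists of a $\mathrm{Poisson}(\bar m)$ distributed number of i.i.d. points with an isotropic probability density $f$ (one that depends only on $\|\mathbf s\|$). For every $\mathbf z\in\mathbb R^2$ the distance to the origin of an offspring point with cluster centre $\mathbf z$ has a probability density that depends on $\mathbf z$ only through $\|\mathbf z\|$; write it $f_{\rm d}(\cdot\,|\,\|\mathbf z\|)$. Base stations have intensity $\lambda_{\rm b}$. Replace the typical cell by the disc $b(o,R_{\rm c})$ with the same area $A=\pi R_{\rm c}^2$, where $A$ is a random variable that is independent of $\Phi_{\rm u}$ and such that $\lambda_{\rm b}A$ is Gamma distributed with shape $3.5$ and scale $1/3.5$. Then $\sqrt{\pi\lambda_{\rm b}}\,R_{\rm c}$ has the Nakagami density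 $g(x)=\frac{2\cdot 3.5^{3.5}}{\Gamma(3.5)}x^{6}e^{-3.5x^2}$, $x>0$, so $R_{\rm c}$ has the density $f_{R_{\rm c}}(r)=\sqrt{\pi\lambda_{\rm b}}\;g\big(\sqrt{\pi\lambda_{\rm b}}\,r\big)$, $r>0$. The load $\Phi_{{\rm u}_0}=\Phi_{\rm u}(b(o,R_{\rm c}))$ is almost surely finite, and for every $\theta\in\mathbb C$ with $\mathbb E\big[|\theta|^{\Phi_{{\rm u}_0}}\big]<\infty$, in particular whenever $|\theta|\le 1$, its probability generating function is $$\mathbb E\big[\theta^{\Phi_{{\rm u}_0}}\big]=\int_0^\infty \exp\!\bigg(-2\pi\lambda_{\rm p}\int_0^\infty\Big(1-\exp\Big(-\bar m\int_0^r(1-\theta)f_{\rm d}(u|v)\,{\rm d}u\Big)\Big)v\,{\rm d}v\bigg)f_{R_{\rm c}}(r)\,{\rm d}r,$$ where the integrals over $v$ (for each $r>0$) and over $r$ converge absolutely. -/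

import Mathlib

open MeasureTheory ProbabilityTheory Set
open scoped NNReal ENNReal

noncomputable section

/-- The Euclidean plane. -/
abbrev Plane : Type := EuclideanSpace ℝ (Fin 2)

/-- A Poisson point process with intensity measure `Lam`, as a random (counting) measure:
the number of points in a Borel set of finite intensity is Poisson with mean `Lam B`, and the
numbers of points in finitely many disjoint Borel sets are independent. -/
structure IsPoissonProcess {Ω : Type*} [MeasurableSpace Ω] (P : Measure Ω)
    (Lam : Measure Plane) (Φ : Ω → Measure Plane) : Prop where
  measurable : Measurable Φ
  law : ∀ B : Set Plane, MeasurableSet B → Lam B < ∞ →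
    HasLaw (fun ω => Φ ω B)
      ((poissonMeasure (Lam B).toNNReal).map (fun n : ℕ => (n : ℝ≥0∞))) P
  indep : ∀ (n : ℕ) (B : Fin n → Set Plane), (∀ i, MeasurableSet (B i)) →
    (∀ i, Lam (B i) < ∞) → Pairwise (fun i j => Disjoint (B i) (B j)) →
    iIndepFun (fun i ω => Φ ω (B i)) P

/-- The probability measure on the plane with density `f`. -/
def offspringLaw (f : Plane → ℝ) : Measure Plane :=
  volume.withDensity (fun s => ENNReal.ofReal (f s))

/-- The ingredients of a Poisson cluster process with parent intensity `lamP`, mean number of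
offspring `mbar` and offspring density `f`: the parent points `Z i` form a homogeneous Poisson
process; the `i`-th parent has `K i` offspring, at the positions `Z i + S i j` for `j < K i`;
the `K i` are i.i.d. Poisson, the `S i j` are i.i.d. with density `f`, and parents, numbers and
displacements are mutually independent. -/
structure IsPoissonClusterModel {Ω : Type*} [MeasurableSpace Ω] (P : Measure Ω)
    (lamP mbar : ℝ≥0) (f : Plane → ℝ)
    (Z : ℕ → Ω → Plane) (K : ℕ → Ω → ℕ) (S : ℕ → ℕ → Ω → Plane) : Prop where
  measurable_parent : ∀ i, Measurable (Z i)
  measurable_number : ∀ i, Measurable (K i)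
  measurable_displacement : ∀ i j, Measurable (S i j)
  parents : IsPoissonProcess P (lamP • volume)
    (fun ω => Measure.sum (fun i => Measure.dirac (Z i ω)))
  law_number : ∀ i, HasLaw (K i) (poissonMeasure mbar) P
  law_displacement : ∀ i j, HasLaw (S i j) (offspringLaw f) P
  indep_number : iIndepFun K P
  indep_displacement : iIndepFun (fun p : ℕ × ℕ => S p.1 p.2) P
  indep_number_displacement :
    IndepFun (fun ω i => K i ω) (fun ω (p : ℕ × ℕ) => S p.1 p.2 ω) P
  indep_parent :
    IndepFun (fun ω i => Z i ω)
      (fun ω => ((fun i => K i ω), (fun p : ℕ × ℕ => S p.1 p.2 ω))) P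

/-- The Poisson cluster process, the superposition of all clusters, as a counting measure. -/
def clusterProcess {Ω : Type*} (Z : ℕ → Ω → Plane) (K : ℕ → Ω → ℕ) (S : ℕ → ℕ → Ω → Plane)
    (ω : Ω) : Measure Plane :=
  Measure.sum (fun i => ∑ j ∈ Finset.range (K i ω), Measure.dirac (Z i ω + S i j ω))

/-- The radius of a disc of area `a`. -/
def discRadius (a : ℝ) : ℝ := √(a / Real.pi)

/-- The number of points of `Φ` in the disc of radius `R` around the origin. -/
def discLoad {Ω : Type*} (Φ : Ω → Measure Plane) (R : Ω → ℝ) (ω : Ω) : ℕ :=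
  ⌊(Φ ω (Metric.ball 0 (R ω))).toReal⌋₊

/-- The law of the distance to the origin of an offspring point of a cluster centred at `z`. -/
def distanceLaw (f : Plane → ℝ) (z : Plane) : Measure ℝ :=
  (offspringLaw f).map (fun s => ‖z + s‖)

/-- `fd f u v` is the probability density, at `u`, of the distance to the origin of an offspring
point whose cluster centre is at distance `v` from the origin. -/
def fd (f : Plane → ℝ) (u v : ℝ) : ℝ :=
  ((distanceLaw f !₂[v, 0]).rnDeriv volume u).toReal

/-- The Nakagami density with shape `3.5` and spread `1`, for `x > 0`. -/
def nakagamiPDF (x : ℝ) : ℝ :=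
  2 * (3.5 : ℝ) ^ (3.5 : ℝ) / Real.Gamma 3.5 * x ^ 6 * Real.exp (-3.5 * x ^ 2)

/-- The density, for `r > 0`, of `R` when `√(π λ_b) R` has the density `nakagamiPDF`. -/
def radiusPDF (lamB : ℝ≥0) (r : ℝ) : ℝ :=
  √(Real.pi * lamB) * nakagamiPDF (√(Real.pi * lamB) * r)

/-- The integrand `(1 - exp (-m̄ ∫₀^r (1 - θ) f_d(u|v) du)) v`. -/
def parentIntegrand (mbar : ℝ≥0) (f : Plane → ℝ) (θ : ℂ) (r v : ℝ) : ℂ :=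
  (1 - Complex.exp (-(mbar : ℂ) * ∫ u in (0 : ℝ)..r, (1 - θ) * (fd f u v : ℂ))) * (v : ℂ)

/-- The integrand `exp (-2πλ_p ∫₀^∞ (1 - exp (-m̄ ∫₀^r (1 - θ) f_d(u|v) du)) v dv) f_{R_c}(r)`. -/
def loadIntegrand (lamB lamP mbar : ℝ≥0) (f : Plane → ℝ) (θ : ℂ) (r : ℝ) : ℂ :=
  Complex.exp (-2 * (Real.pi : ℂ) * (lamP : ℂ) *
    ∫ v in Ioi (0 : ℝ), parentIntegrand mbar f θ r v) * (radiusPDF lamB r : ℂ)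

end

/-! Fix a radius r. The expectation of θ^N, with N the number of users in the disc, is a product
over clusters. Given the parents, a cluster centred at z contributes exp(m̄(θ-1)p(z)), where p(z) is
the probability that an offspring point of z lands in the disc. Averaging over the Poisson parents
gives exp(λ_p ∫ (exp(m̄(θ-1)p(z)) - 1) dz).

This computation is carried out only for real θ = 1 + t ≥ 1 (`lintegral_iSup_prod_cluster`). There
all factors are at least 1, so the products over the first n clusters increase and Tonelli and
monotone convergence need no integrability. The parents enter through
`lintegral_eexp_lintegral_poissonProcess`, proved for simple functions from the Poisson counts on
disjoint sets and extended by monotone limits. The formula also shows that N has all exponential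
moments, hence is almost surely finite.

Since p is bounded and integrable, both sides are entire functions of θ. They agree on [1, ∞), so
they agree on ℂ (`integral_pow_eq_cexp`).

Isotropy makes p(z) a function of ‖z‖, namely the integral of `fd` over [0, r], and polar
coordinates turn dz into 2πv dv. Finally the independent random radius is integrated out by Fubini.
After this mixing the moment of order |θ| > 1 may be infinite, which is why integrability becomes a
hypothesis only at this stage. -/

/-! ### The exponential on [0, ∞] -/

/-- The exponential function on the extended nonnegative reals. -/
noncomputable def eexp (x : ℝ≥0∞) : ℝ≥0∞ := EReal.exp (x : EReal)

lemma eexp_zero : eexp 0 = 1 := by simp [eexp]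

lemma eexp_add (x y : ℝ≥0∞) : eexp (x + y) = eexp x * eexp y := by
  simp [eexp, EReal.coe_ennreal_add, EReal.exp_add]

lemma eexp_coe (x : ℝ≥0) : eexp x = ENNReal.ofReal (Real.exp x) := by
  exact EReal.exp_coe (x : ℝ)

lemma eexp_ofReal {x : ℝ} (hx : 0 ≤ x) : eexp (ENNReal.ofReal x) = ENNReal.ofReal (Real.exp x) := by
  rw [ENNReal.ofReal, eexp_coe, Real.coe_toNNReal x hx]

lemma eexp_ne_top {x : ℝ≥0∞} (hx : x ≠ ∞) : eexp x ≠ ∞ := by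
  lift x to ℝ≥0 using hx
  simp [eexp_coe]

lemma one_le_eexp (x : ℝ≥0∞) : 1 ≤ eexp x := by
  rw [eexp, EReal.one_le_exp_iff]
  exact EReal.coe_ennreal_nonneg x

lemma monotone_eexp : Monotone eexp := fun x y h => by
  rw [eexp, eexp, EReal.exp_le_exp_iff]
  exact_mod_cast h

lemma continuous_eexp : Continuous eexp :=
  ENNReal.continuous_exp.comp continuous_coe_ennreal_ereal

lemma measurable_eexp : Measurable eexp := continuous_eexp.measurable

lemma Measurable.eexp {α : Type*} [MeasurableSpace α] {k : α → ℝ≥0∞} (hk : Measurable k) :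
    Measurable fun x => eexp (k x) := measurable_eexp.comp hk

lemma eexp_sum {ι : Type*} (s : Finset ι) (x : ι → ℝ≥0∞) :
    eexp (∑ i ∈ s, x i) = ∏ i ∈ s, eexp (x i) := by
  classical
  induction s using Finset.induction_on with
  | empty => simp [eexp_zero]
  | insert a s ha ih => rw [Finset.sum_insert ha, Finset.prod_insert ha, eexp_add, ih]

lemma eexp_mul_natCast (x : ℝ≥0∞) (n : ℕ) : eexp (x * n) = eexp x ^ n := by
  induction n with
  | zero => simp [eexp_zero]
  | succ n ih => rw [Nat.cast_succ, mul_add, mul_one, eexp_add, ih, pow_succ]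

lemma eexp_iSup {x : ℕ → ℝ≥0∞} (hx : Monotone x) : eexp (⨆ n, x n) = ⨆ n, eexp (x n) :=
  tendsto_nhds_unique
    ((continuous_eexp.tendsto _).comp (tendsto_atTop_iSup hx))
    (tendsto_atTop_iSup (monotone_eexp.comp hx))

/-! ### Exponential moments of Poisson variables and Poisson processes -/

/-- The probability generating function of the Poisson distribution at `1 + t`. -/
lemma lintegral_one_add_pow_poissonMeasure (m : ℝ≥0) {t : ℝ≥0∞} (ht : t ≠ ∞) :
    ∫⁻ n : ℕ, (1 + t) ^ n ∂poissonMeasure m = eexp (m * t) := by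
  lift t to ℝ≥0 using ht
  have h (n : ℕ) : poissonMeasure m {n} * (1 + (t : ℝ≥0∞)) ^ n =
      ENNReal.ofReal (Real.exp (-m) * (m * (1 + t)) ^ n / n.factorial) := by
    have : (1 + (t : ℝ≥0∞)) ^ n = ENNReal.ofReal ((1 + t) ^ n) := by
      rw [ENNReal.ofReal_pow (by positivity), ENNReal.ofReal_add (by simp) (by simp)]
      simp
    rw [poissonMeasure_singleton, this, ← ENNReal.ofReal_mul (by positivity)]
    congr 1
    rw [mul_pow]
    ring
  have hs : HasSum (fun n : ℕ => Real.exp (-m) * (m * (1 + t)) ^ n / n.factorial)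
      (Real.exp (m * t)) := by
    have := (NormedSpace.expSeries_div_hasSum_exp ((m : ℝ) * (1 + t))).mul_left (Real.exp (-m))
    rw [← Real.exp_eq_exp_ℝ, ← Real.exp_add,
      show -(m : ℝ) + m * (1 + t) = m * t by ring] at this
    simpa only [mul_div_assoc] using this
  rw [lintegral_countable']
  simp_rw [mul_comm _ (poissonMeasure m _), h]
  rw [← ENNReal.ofReal_tsum_of_nonneg (fun n => by positivity) hs.summable, hs.tsum_eq,
    ← ENNReal.coe_mul, eexp_coe]
  simp

/-- The integral of `g` against the process is a combination of the counts on the disjoint level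
sets of `g`. These counts are independent and Poisson, so the expectation factors, and each factor
is a Poisson generating function at e^c = 1 + (e^c - 1). -/
lemma lintegral_eexp_simpleFunc {Ω : Type*} [MeasurableSpace Ω] {P : Measure Ω}
    [IsProbabilityMeasure P] {Lam : Measure Plane} {Φ : Ω → Measure Plane}
    (hΦ : IsPoissonProcess P Lam Φ) (g : SimpleFunc Plane ℝ≥0∞) (hg : ∀ x, g x ≠ ∞)
    (hint : ∫⁻ x, g x ∂Lam ≠ ∞) :
    ∫⁻ ω, eexp (∫⁻ x, g x ∂Φ ω) ∂P = eexp (∫⁻ x, (eexp (g x) - 1) ∂Lam) := by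
  have hmeas (B : Set Plane) (hB : MeasurableSet B) : Measurable fun ω => Φ ω B :=
    (Measure.measurable_coe hB).comp hΦ.measurable
  -- The value 0 is dropped because its level set may have infinite intensity; the other level sets
  -- have finite intensity by Markov's inequality.
  set s : Finset ℝ≥0∞ := g.range.filter (· ≠ 0) with hs
  have hcount (ν : Measure Plane) (k : ℝ≥0∞ → ℝ≥0∞) (hk : k 0 = 0) :
      ∫⁻ x, k (g x) ∂ν = ∑ c ∈ s, k c * ν (g ⁻¹' {c}) := by
    have : ∫⁻ x, k (g x) ∂ν = (g.map k).lintegral ν := by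
      rw [← SimpleFunc.lintegral_eq_lintegral]; rfl
    rw [this, SimpleFunc.map_lintegral, hs, Finset.sum_filter_of_ne]
    intro c _ hc h0
    simp [h0, hk] at hc
  have hfin (c : ℝ≥0∞) (hc : c ∈ s) : Lam (g ⁻¹' {c}) < ∞ := by
    have hc0 : c ≠ 0 := (Finset.mem_filter.1 hc).2
    have h1 : c * Lam (g ⁻¹' {c}) ≤ ∫⁻ x, g x ∂Lam := by
      refine le_of_le_of_eq ?_ (hcount Lam id rfl).symm
      exact Finset.single_le_sum (f := fun c => id c * Lam (g ⁻¹' {c}))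
        (fun _ _ => zero_le) hc
    by_contra hcon
    rw [not_lt, top_le_iff] at hcon
    rw [hcon, ENNReal.mul_top hc0, top_le_iff] at h1
    exact hint h1
  have hctop (c : ℝ≥0∞) (hc : c ∈ s) : c ≠ ∞ := by
    obtain ⟨x, rfl⟩ := SimpleFunc.mem_range.1 (Finset.mem_filter.1 hc).1
    exact hg x
  let e := s.equivFin
  let B : Fin s.card → Set Plane := fun i => g ⁻¹' {(e.symm i : ℝ≥0∞)}
  have hind : iIndepFun (fun i ω => Φ ω (B i)) P := by
    refine hΦ.indep _ B (fun i => g.measurableSet_fiber _) (fun i => hfin _ (e.symm i).2) ?_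
    intro i j hij
    refine Disjoint.preimage _ (Set.disjoint_singleton.2 fun h => hij ?_)
    exact e.symm.injective (Subtype.ext h)
  have hind' := hind.comp (fun i x => eexp ((e.symm i : ℝ≥0∞) * x))
    (fun i => (measurable_const.mul measurable_id).eexp)
  have hreindex (k : ℝ≥0∞ → ℝ≥0∞) : ∏ c ∈ s, k c = ∏ i, k (e.symm i) := by
    rw [← Finset.prod_coe_sort, ← Equiv.prod_comp e.symm]
  have hone (c : ℝ≥0∞) (hc : c ∈ s) : ∫⁻ ω, eexp (c * Φ ω (g ⁻¹' {c})) ∂P =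
      eexp ((eexp c - 1) * Lam (g ⁻¹' {c})) := by
    have hl := hΦ.law (g ⁻¹' {c}) (g.measurableSet_fiber _) (hfin c hc)
    have hm : Measurable fun x : ℝ≥0∞ => eexp (c * x) := (measurable_const_mul c).eexp
    rw [hl.lintegral_comp hm.aemeasurable, lintegral_map hm (measurable_of_countable _)]
    simp_rw [eexp_mul_natCast]
    have h1 : eexp c = 1 + (eexp c - 1) := (add_tsub_cancel_of_le (one_le_eexp c)).symm
    rw [h1, lintegral_one_add_pow_poissonMeasure _
      (ENNReal.sub_ne_top (eexp_ne_top (hctop c hc))), ← h1,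
      ENNReal.coe_toNNReal (hfin c hc).ne, mul_comm]
  have hΦcount (ω : Ω) : eexp (∫⁻ x, g x ∂Φ ω) =
      ∏ i, eexp ((e.symm i : ℝ≥0∞) * Φ ω (B i)) := by
    rw [← hreindex fun c => eexp (c * Φ ω (g ⁻¹' {c})), ← eexp_sum]
    exact congrArg eexp (hcount (Φ ω) id rfl)
  simp_rw [hΦcount]
  rw [lintegral_prod_eq_prod_lintegral_of_indepFun _
      (fun i ω => eexp ((e.symm i : ℝ≥0∞) * Φ ω (B i))) hind'
    (fun i => (measurable_const.mul (hmeas _ (g.measurableSet_fiber _))).eexp),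
    hcount Lam (fun c => eexp c - 1) (by simp [eexp_zero]), eexp_sum, hreindex]
  exact Finset.prod_congr rfl fun i _ => hone _ (e.symm i).2

/-- The exponential moments of a Poisson process. -/
theorem lintegral_eexp_lintegral_poissonProcess {Ω : Type*} [MeasurableSpace Ω] {P : Measure Ω}
    [IsProbabilityMeasure P] {Lam : Measure Plane} {Φ : Ω → Measure Plane}
    (hΦ : IsPoissonProcess P Lam Φ) {h : Plane → ℝ≥0∞} (hh : Measurable h)
    (hint : ∫⁻ x, h x ∂Lam ≠ ∞) :
    ∫⁻ ω, eexp (∫⁻ x, h x ∂Φ ω) ∂P = eexp (∫⁻ x, (eexp (h x) - 1) ∂Lam) := by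
  set g := SimpleFunc.eapprox h
  have hmono : Monotone fun n x => g n x := fun m n hmn => SimpleFunc.monotone_eapprox h hmn
  have hsup (x : Plane) : ⨆ n, g n x = h x := SimpleFunc.iSup_eapprox_apply hh x
  have hle (n : ℕ) (x : Plane) : g n x ≤ h x := (le_iSup (fun n => g n x) n).trans (hsup x).le
  have hmonoI (ν : Measure Plane) : Monotone fun n => ∫⁻ x, g n x ∂ν :=
    fun m n hmn => lintegral_mono (hmono hmn)
  have hI (ν : Measure Plane) : ∫⁻ x, h x ∂ν = ⨆ n, ∫⁻ x, g n x ∂ν := by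
    rw [← lintegral_iSup (fun n => (g n).measurable) hmono]
    simp_rw [hsup]
  have hmonoS : Monotone fun n x => eexp (g n x) - 1 := fun m n hmn x =>
    tsub_le_tsub_right (monotone_eexp (hmono hmn x)) 1
  -- Subtracting the constant 1 commutes with suprema, so the right-hand side is a monotone limit as
  -- well.
  have hsub (x : Plane) : eexp (h x) - 1 = ⨆ n, (eexp (g n x) - 1) := by
    rw [← hsup, eexp_iSup (fun m n hmn => hmono hmn x), ENNReal.iSup_sub]
  have hmeas (n : ℕ) : Measurable fun ω => eexp (∫⁻ x, g n x ∂Φ ω) :=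
    ((Measure.measurable_lintegral (g n).measurable).comp hΦ.measurable).eexp
  have hmeasS (n : ℕ) : Measurable fun x => eexp (g n x) - 1 :=
    (g n).measurable.eexp.sub measurable_const
  simp_rw [hI, eexp_iSup (hmonoI _), hsub]
  rw [lintegral_iSup hmeas
      (fun m n hmn ω => monotone_eexp (hmonoI _ hmn)),
    lintegral_iSup hmeasS hmonoS,
    eexp_iSup (fun m n hmn => lintegral_mono (hmonoS hmn))]
  refine iSup_congr fun n => lintegral_eexp_simpleFunc hΦ (g n)
    (fun x => (SimpleFunc.eapprox_lt_top h n x).ne) ?_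
  exact ((lintegral_mono (hle n)).trans_lt hint.lt_top).ne

/-! ### The generating functional of the cluster process -/

/-- Serves products and sums whose number of terms is the random cluster size. -/
lemma Measurable.eval_nat {α β : Type*} [MeasurableSpace α] [MeasurableSpace β] {g : ℕ → α → β}
    (hg : ∀ n, Measurable (g n)) {κ : α → ℕ} (hκ : Measurable κ) :
    Measurable fun x => g (κ x) x :=
  (measurable_from_prod_countable_right (f := fun p : ℕ × α => g p.1 p.2) hg).comp
    (hκ.prodMk measurable_id)

section Cluster

variable {Ω : Type*} [MeasurableSpace Ω] {P : Measure Ω} [IsProbabilityMeasure P]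
  {lamP mbar : ℝ≥0} {f : Plane → ℝ} {Z : ℕ → Ω → Plane} {K : ℕ → Ω → ℕ} {S : ℕ → ℕ → Ω → Plane}

/-- With the cluster sizes frozen as well, the i.i.d. displacements turn cluster i into a power with
exponent its size; averaging over the independent Poisson sizes gives exponentials. -/
lemma lintegral_prod_cluster_fixed_parents (h : IsPoissonClusterModel P lamP mbar f Z K S)
    [IsProbabilityMeasure (offspringLaw f)]
    {k : Plane → ℝ≥0∞} (hk : Measurable k) (hk_top : ∀ z, ∫⁻ s, k (z + s) ∂offspringLaw f ≠ ∞)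
    (z : ℕ → Plane) (n : ℕ) :
    ∫⁻ ω, ∏ i ∈ Finset.range n, ∏ j ∈ Finset.range (K i ω), (1 + k (z i + S i j ω)) ∂P =
      eexp (∑ i ∈ Finset.range n, mbar * ∫⁻ s, k (z i + s) ∂offspringLaw f) := by
  have hk' (i : ℕ) : Measurable fun s => 1 + k (z i + s) :=
    measurable_const.add (hk.comp (measurable_const_add _))
  have hK : Measurable fun ω i => K i ω := measurable_pi_lambda _ h.measurable_number
  have hS : Measurable fun ω (p : ℕ × ℕ) => S p.1 p.2 ω :=
    measurable_pi_lambda _ fun p => h.measurable_displacement p.1 p.2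
  let q : (ℕ → ℕ) × (ℕ × ℕ → Plane) → ℝ≥0∞ := fun x =>
    ∏ i ∈ Finset.range n, ∏ j ∈ Finset.range (x.1 i), (1 + k (z i + x.2 (i, j)))
  have hq : Measurable q := by
    refine Finset.measurable_prod _ fun i _ => ?_
    refine Measurable.eval_nat (g := fun m (x : (ℕ → ℕ) × (ℕ × ℕ → Plane)) =>
      ∏ j ∈ Finset.range m, (1 + k (z i + x.2 (i, j)))) (fun m => ?_)
      ((measurable_pi_apply i).comp measurable_fst)
    exact Finset.measurable_prod _ fun j _ =>
      (hk' i).comp ((measurable_pi_apply (i, j)).comp measurable_snd)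
  have hS_int (κ : ℕ → ℕ) : ∫⁻ ω, q (κ, fun p => S p.1 p.2 ω) ∂P =
      ∏ i ∈ Finset.range n, (1 + ∫⁻ s, k (z i + s) ∂offspringLaw f) ^ κ i := by
    have hi := h.indep_displacement.comp (fun p s => 1 + k (z p.1 + s)) (fun p => hk' p.1)
    -- The double product is flattened to one over pairs (i, j) with j < κ i, since independence is
    -- assumed for the family indexed by pairs.
    have := lintegral_prod_eq_prod_lintegral_of_indepFun
      ((Finset.range n).sigma (fun i => Finset.range (κ i)) |>.map
        (Equiv.sigmaEquivProd ℕ ℕ).toEmbedding)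
      (fun p ω => 1 + k (z p.1 + S p.1 p.2 ω)) hi
      (fun p => (hk' p.1).comp (h.measurable_displacement p.1 p.2))
    simp only [Finset.prod_map, Finset.prod_sigma, Equiv.coe_toEmbedding,
      Equiv.sigmaEquivProd_apply] at this
    refine this.trans (Finset.prod_congr rfl fun i _ => ?_)
    have hone (j : ℕ) : ∫⁻ ω, (1 + k (z i + S i j ω)) ∂P =
        1 + ∫⁻ s, k (z i + s) ∂offspringLaw f := by
      rw [(h.law_displacement i j).lintegral_comp (f := fun s => 1 + k (z i + s))
        (hk' i).aemeasurable, lintegral_add_left measurable_const]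
      simp
    simp [hone]
  have hprod := (indepFun_iff_map_prod_eq_prod_map_map hK.aemeasurable hS.aemeasurable).1
    h.indep_number_displacement
  have := Measure.isProbabilityMeasure_map (μ := P) hS.aemeasurable
  calc _ = ∫⁻ x, q x ∂(P.map fun ω => ((fun i => K i ω), fun p : ℕ × ℕ => S p.1 p.2 ω)) :=
        (lintegral_map hq (hK.prodMk hS)).symm
    _ = ∫⁻ ω, ∏ i ∈ Finset.range n,
          (1 + ∫⁻ s, k (z i + s) ∂offspringLaw f) ^ K i ω ∂P := by
        rw [hprod, lintegral_prod _ hq.aemeasurable, lintegral_map hq.lintegral_prod_right' hK]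
        refine lintegral_congr fun ω => ?_
        rw [← hS_int]
        exact lintegral_map (hq.comp measurable_prodMk_left) hS
    _ = ∏ i ∈ Finset.range n, eexp (mbar * ∫⁻ s, k (z i + s) ∂offspringLaw f) := by
        have hi := h.indep_number.comp
          (fun i m => (1 + ∫⁻ s, k (z i + s) ∂offspringLaw f) ^ m)
          (fun i => measurable_of_countable _)
        rw [lintegral_prod_eq_prod_lintegral_of_indepFun _
          (fun i ω => (1 + ∫⁻ s, k (z i + s) ∂offspringLaw f) ^ K i ω) hi
          (fun i => (measurable_of_countable _).comp (h.measurable_number i))]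
        refine Finset.prod_congr rfl fun i _ => ?_
        rw [(h.law_number i).lintegral_comp
          (f := fun m => (1 + ∫⁻ s, k (z i + s) ∂offspringLaw f) ^ m)
          (measurable_of_countable _).aemeasurable,
          lintegral_one_add_pow_poissonMeasure _ (hk_top _)]
    _ = _ := (eexp_sum _ _).symm

/-- Independence of the parent sequence from sizes and displacements lets the parents be frozen. No
independence among the parents is used, only that of the whole sequence from the rest. -/
lemma lintegral_prod_cluster (h : IsPoissonClusterModel P lamP mbar f Z K S)
    [IsProbabilityMeasure (offspringLaw f)]
    {k : Plane → ℝ≥0∞} (hk : Measurable k) (hk_top : ∀ z, ∫⁻ s, k (z + s) ∂offspringLaw f ≠ ∞)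
    (n : ℕ) :
    ∫⁻ ω, ∏ i ∈ Finset.range n, ∏ j ∈ Finset.range (K i ω), (1 + k (Z i ω + S i j ω)) ∂P =
      ∫⁻ ω, eexp (∑ i ∈ Finset.range n, mbar * ∫⁻ s, k (Z i ω + s) ∂offspringLaw f) ∂P := by
  have hZ : Measurable fun ω i => Z i ω := measurable_pi_lambda _ h.measurable_parent
  have hKS : Measurable fun ω => ((fun i => K i ω), fun p : ℕ × ℕ => S p.1 p.2 ω) :=
    (measurable_pi_lambda _ h.measurable_number).prodMk
      (measurable_pi_lambda _ fun p => h.measurable_displacement p.1 p.2)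
  let q : (ℕ → Plane) × ((ℕ → ℕ) × (ℕ × ℕ → Plane)) → ℝ≥0∞ := fun x =>
    ∏ i ∈ Finset.range n, ∏ j ∈ Finset.range (x.2.1 i), (1 + k (x.1 i + x.2.2 (i, j)))
  have hq : Measurable q := by
    refine Finset.measurable_prod _ fun i _ => ?_
    refine Measurable.eval_nat (g := fun m (x : (ℕ → Plane) × ((ℕ → ℕ) × (ℕ × ℕ → Plane))) =>
      ∏ j ∈ Finset.range m, (1 + k (x.1 i + x.2.2 (i, j)))) (fun m => ?_)
      ((measurable_pi_apply i).comp (measurable_fst.comp measurable_snd))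
    exact Finset.measurable_prod _ fun j _ => measurable_const.add (hk.comp
      (((measurable_pi_apply i).comp measurable_fst).add
        ((measurable_pi_apply (i, j)).comp (measurable_snd.comp measurable_snd))))
  have := Measure.isProbabilityMeasure_map (μ := P) hKS.aemeasurable
  calc _ = ∫⁻ x, q x ∂(P.map fun ω =>
          ((fun i => Z i ω), ((fun i => K i ω), fun p : ℕ × ℕ => S p.1 p.2 ω))) :=
        (lintegral_map hq (hZ.prodMk hKS)).symm
    _ = _ := by
        rw [(indepFun_iff_map_prod_eq_prod_map_map hZ.aemeasurable hKS.aemeasurable).1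
          h.indep_parent, lintegral_prod _ hq.aemeasurable,
          lintegral_map hq.lintegral_prod_right' hZ]
        refine lintegral_congr fun ω => ?_
        exact (lintegral_map (hq.comp measurable_prodMk_left) hKS).trans
          (lintegral_prod_cluster_fixed_parents h hk hk_top _ n)

/-- The probability generating functional of a Poisson cluster process, at `1 + k` for `k ≥ 0`. -/
theorem lintegral_iSup_prod_cluster (h : IsPoissonClusterModel P lamP mbar f Z K S)
    [IsProbabilityMeasure (offspringLaw f)]
    {k : Plane → ℝ≥0∞} (hk : Measurable k) (hk_top : ∀ z, ∫⁻ s, k (z + s) ∂offspringLaw f ≠ ∞)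
    (hk_int : ∫⁻ z, k z ≠ ∞) :
    ∫⁻ ω, ⨆ n, ∏ i ∈ Finset.range n, ∏ j ∈ Finset.range (K i ω), (1 + k (Z i ω + S i j ω)) ∂P =
      eexp (lamP * ∫⁻ z, (eexp (mbar * ∫⁻ s, k (z + s) ∂offspringLaw f) - 1)) := by
  set H : Plane → ℝ≥0∞ := fun z => mbar * ∫⁻ s, k (z + s) ∂offspringLaw f with hH
  have hkadd : Measurable fun p : Plane × Plane => k (p.1 + p.2) :=
    hk.comp (measurable_fst.add measurable_snd)
  have hHm : Measurable H := measurable_const.mul hkadd.lintegral_prod_right'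
  -- By Tonelli and translation invariance, the integral of `H` is m̄ times that of `k`.
  have hHint : ∫⁻ z, H z ≠ ∞ := by
    rw [lintegral_const_mul _ hkadd.lintegral_prod_right',
      lintegral_lintegral_swap hkadd.aemeasurable]
    simp_rw [fun s => lintegral_add_right_eq_self (μ := (volume : Measure Plane)) k s]
    simpa using ENNReal.mul_ne_top ENNReal.coe_ne_top hk_int
  have hpois := lintegral_eexp_lintegral_poissonProcess h.parents hHm
    (by
      rw [lintegral_smul_measure, ENNReal.smul_def, smul_eq_mul]
      exact ENNReal.mul_ne_top ENNReal.coe_ne_top hHint)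
  rw [lintegral_smul_measure, ENNReal.smul_def, smul_eq_mul] at hpois
  simp only [lintegral_sum_measure, lintegral_dirac] at hpois
  have hterm (n : ℕ) : Measurable fun ω =>
      ∏ i ∈ Finset.range n, ∏ j ∈ Finset.range (K i ω), (1 + k (Z i ω + S i j ω)) := by
    refine Finset.measurable_prod _ fun i _ => ?_
    refine Measurable.eval_nat (g := fun m ω => ∏ j ∈ Finset.range m, (1 + k (Z i ω + S i j ω)))
      (fun m => ?_) (h.measurable_number i)
    exact Finset.measurable_prod _ fun j _ => measurable_const.add
      (hk.comp ((h.measurable_parent i).add (h.measurable_displacement i j)))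
  rw [lintegral_iSup hterm]
  · simp_rw [lintegral_prod_cluster h hk hk_top]
    rw [← lintegral_iSup]
    · rw [← hpois]
      refine lintegral_congr fun ω => ?_
      rw [ENNReal.tsum_eq_iSup_nat, eexp_iSup]
      exact fun a b hab => Finset.sum_le_sum_of_subset (Finset.range_mono hab)
    · exact fun n => (Finset.measurable_sum _ fun i _ => hHm.comp (h.measurable_parent i)).eexp
    · exact fun a b hab ω => monotone_eexp
        (Finset.sum_le_sum_of_subset (Finset.range_mono hab))
  · intro a b hab ω
    exact Finset.prod_le_prod_of_subset_of_one_le' (Finset.range_mono hab)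
      fun i _ _ => Finset.one_le_prod' fun j _ => le_self_add

end Cluster

/-! ### Analytic continuation from [1, ∞) to the complex plane -/

/-- The bound is linear in x, so that integrability of a bounded `h` suffices even over a space of
infinite measure such as the plane. -/
lemma norm_cexp_mul_sub_one_le (c : ℂ) {x C : ℝ} (hx : 0 ≤ x) (hC : x ≤ C) :
    ‖Complex.exp (c * x) - 1‖ ≤ ‖c‖ * Real.exp (‖c‖ * C) * x := by
  have h := Complex.norm_exp_sub_sum_le_norm_mul_exp (c * x) 1
  simp only [Finset.range_one, Finset.sum_singleton, pow_zero, Nat.factorial_zero, Nat.cast_one,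
    div_one, pow_one, norm_mul, Complex.norm_real, Real.norm_of_nonneg hx] at h
  calc _ ≤ ‖c‖ * x * Real.exp (‖c‖ * x) := h
    _ ≤ ‖c‖ * x * Real.exp (‖c‖ * C) := by gcongr
    _ = _ := by ring

section Analytic

variable {α Ω : Type*} [MeasurableSpace α] [MeasurableSpace Ω]

lemma integrable_cexp_mul_sub_one {μ : Measure α} {h : α → ℝ} {C : ℝ} (hh : Integrable h μ)
    (h0 : ∀ x, 0 ≤ h x) (hC : ∀ x, h x ≤ C) (c : ℂ) :
    Integrable (fun x => Complex.exp (c * h x) - 1) μ := by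
  refine Integrable.mono' (hh.const_mul (‖c‖ * Real.exp (‖c‖ * C))) ?_
    (Filter.Eventually.of_forall fun x => norm_cexp_mul_sub_one_le c (h0 x) (hC x))
  have := Complex.continuous_ofReal.comp_aestronglyMeasurable hh.aestronglyMeasurable
  exact (Complex.continuous_exp.comp_aestronglyMeasurable (this.const_mul c)).sub
    aestronglyMeasurable_const

lemma differentiable_integral_cexp_mul_sub_one {μ : Measure α} {h : α → ℝ} {C : ℝ}
    (hh : Integrable h μ) (h0 : ∀ x, 0 ≤ h x) (hC : ∀ x, h x ≤ C) :
    Differentiable ℂ fun c : ℂ => ∫ x, (Complex.exp (c * h x) - 1) ∂μ := by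
  intro c
  have hm := Complex.continuous_ofReal.comp_aestronglyMeasurable hh.aestronglyMeasurable
  refine (hasDerivAt_integral_of_dominated_loc_of_deriv_le (𝕜 := ℂ)
    (F := fun c x => Complex.exp (c * h x) - 1) (F' := fun c x => Complex.exp (c * h x) * h x)
    (bound := fun x => Real.exp ((‖c‖ + 1) * C) * h x) (Metric.ball_mem_nhds c one_pos)
    (Filter.Eventually.of_forall fun c' =>
      (integrable_cexp_mul_sub_one hh h0 hC c').aestronglyMeasurable)
    (integrable_cexp_mul_sub_one hh h0 hC c)
    ((Complex.continuous_exp.comp_aestronglyMeasurable (hm.const_mul c)).mul hm)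
    (Filter.Eventually.of_forall fun x c' hc' => ?_) (hh.const_mul _)
    (Filter.Eventually.of_forall fun x c' _ => ?_)).2.differentiableAt
  · have hc : ‖c'‖ ≤ ‖c‖ + 1 := by
      have h1 := norm_sub_norm_le c' c
      rw [mem_ball_iff_norm] at hc'
      linarith
    rw [norm_mul, Complex.norm_real, Real.norm_of_nonneg (h0 x), Complex.norm_exp]
    refine mul_le_mul_of_nonneg_right (Real.exp_le_exp.2 ?_) (h0 x)
    calc (c' * (h x : ℂ)).re ≤ ‖c' * (h x : ℂ)‖ := Complex.re_le_norm _
      _ = ‖c'‖ * h x := by rw [norm_mul, Complex.norm_real, Real.norm_of_nonneg (h0 x)]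
      _ ≤ _ := mul_le_mul hc (hC x) (h0 x) (by positivity)
  · have := ((hasDerivAt_id c').mul_const (h x : ℂ)).cexp.sub_const 1
    simpa using this

/-- The left side is one term of the binomial expansion of the right. It dominates the derivative of
θ^N by a moment at a larger base. -/
lemma natCast_mul_pow_pred_le (n : ℕ) {x : ℝ} (hx : 0 ≤ x) :
    n * x ^ (n - 1) ≤ (x + 1) ^ n := by
  induction n with
  | zero => simp
  | succ n ih =>
    have h1 : x ^ n ≤ (x + 1) ^ n := pow_le_pow_left₀ hx (by linarith) n
    have h2 : (n : ℝ) * x ^ n ≤ x * (x + 1) ^ n := by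
      rcases n with _ | n
      · simpa using hx
      · calc _ = x * (((n + 1 : ℕ) : ℝ) * x ^ (n + 1 - 1)) := by
              rw [Nat.add_sub_cancel, pow_succ]; ring
          _ ≤ _ := mul_le_mul_of_nonneg_left ih hx
    rw [Nat.add_sub_cancel, pow_succ]
    push_cast
    linarith

lemma differentiable_integral_pow {P : Measure Ω} {N : Ω → ℕ} (hN : Measurable N)
    (hint : ∀ x : ℝ, 1 ≤ x → Integrable (fun ω => x ^ N ω) P) :
    (∀ θ : ℂ, Integrable (fun ω => θ ^ N ω) P) ∧
      Differentiable ℂ fun θ : ℂ => ∫ ω, θ ^ N ω ∂P := by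
  have hmeas (k : ℕ → ℂ) : AEStronglyMeasurable (fun ω => k (N ω)) P :=
    ((measurable_of_countable k).comp hN).aestronglyMeasurable
  have hI (θ : ℂ) : Integrable (fun ω => θ ^ N ω) P := by
    refine (hint (‖θ‖ + 1) (by linarith [norm_nonneg θ])).mono' (hmeas fun n => θ ^ n)
      (Filter.Eventually.of_forall fun ω => ?_)
    rw [norm_pow]
    exact pow_le_pow_left₀ (norm_nonneg θ) (by linarith) _
  refine ⟨hI, fun θ => ?_⟩
  refine (hasDerivAt_integral_of_dominated_loc_of_deriv_le (𝕜 := ℂ)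
    (F := fun θ ω => θ ^ N ω) (F' := fun θ ω => N ω * θ ^ (N ω - 1))
    (bound := fun ω => (‖θ‖ + 1 + 1) ^ N ω) (Metric.ball_mem_nhds θ one_pos)
    (Filter.Eventually.of_forall fun θ' => hmeas fun n => θ' ^ n) (hI θ)
    (hmeas fun n => n * θ ^ (n - 1))
    (Filter.Eventually.of_forall fun ω θ' hθ' => ?_)
    (hint (‖θ‖ + 1 + 1) (by linarith [norm_nonneg θ]))
    (Filter.Eventually.of_forall fun ω θ' _ => hasDerivAt_pow (N ω) θ')).2.differentiableAt
  have hθ : ‖θ'‖ ≤ ‖θ‖ + 1 := by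
    have h1 := norm_sub_norm_le θ' θ
    rw [mem_ball_iff_norm] at hθ'
    linarith
  rw [norm_mul, norm_pow, Complex.norm_natCast]
  calc _ ≤ (N ω : ℝ) * (‖θ‖ + 1) ^ (N ω - 1) := by gcongr
    _ ≤ _ := natCast_mul_pow_pred_le _ (by positivity)

/-- A probability generating function that is given on `[1, ∞)` by an exponential formula is given
by this formula on the whole complex plane. -/
theorem integral_pow_eq_cexp {P : Measure Ω} {N : Ω → ℕ} (hN : Measurable N)
    {μ : Measure α} {h : α → ℝ} {C : ℝ}
    (hh : Integrable h μ) (h0 : ∀ x, 0 ≤ h x) (hC : ∀ x, h x ≤ C) (lam : ℝ)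
    (hreal : ∀ t : ℝ, 0 ≤ t → ∫⁻ ω, ENNReal.ofReal ((1 + t) ^ N ω) ∂P =
      ENNReal.ofReal (Real.exp (lam * ∫ x, (Real.exp (t * h x) - 1) ∂μ))) (θ : ℂ) :
    Integrable (fun ω => θ ^ N ω) P ∧
      ∫ ω, θ ^ N ω ∂P =
        Complex.exp (lam * ∫ x, (Complex.exp ((θ - 1) * h x) - 1) ∂μ) := by
  -- The right-hand side of `hreal` at t = x - 1 is finite.
  have hint (x : ℝ) (hx : 1 ≤ x) : Integrable (fun ω => x ^ N ω) P := by
    have h1 := hreal (x - 1) (by linarith)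
    have hx0 : 0 ≤ x := by linarith
    rw [add_sub_cancel] at h1
    refine (lintegral_ofReal_ne_top_iff_integrable
      ((measurable_of_countable fun n : ℕ => x ^ n).comp hN).aestronglyMeasurable
      (Filter.Eventually.of_forall fun ω => ?_)).1 (h1 ▸ ENNReal.ofReal_ne_top)
    exact pow_nonneg hx0 _
  obtain ⟨hI, hdiff⟩ := differentiable_integral_pow hN hint
  refine ⟨hI θ, ?_⟩
  have hdiff' : Differentiable ℂ fun θ : ℂ =>
      Complex.exp (lam * ∫ x, (Complex.exp ((θ - 1) * h x) - 1) ∂μ) :=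
    (((differentiable_integral_cexp_mul_sub_one hh h0 hC).comp
      (differentiable_id.sub_const 1)).const_mul (lam : ℂ)).cexp
  have hon (x : ℝ) (hx : 1 ≤ x) : ∫ ω, (x : ℂ) ^ N ω ∂P =
      Complex.exp (lam * ∫ x', (Complex.exp (((x : ℂ) - 1) * h x') - 1) ∂μ) := by
    have h1 := hreal (x - 1) (by linarith)
    rw [add_sub_cancel, ← ofReal_integral_eq_lintegral_ofReal (hint x hx)
      (Filter.Eventually.of_forall fun ω => by positivity),
      ENNReal.ofReal_eq_ofReal_iff (integral_nonneg fun ω => by positivity) (by positivity)] at h1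
    have h2 := congrArg (fun y : ℝ => (y : ℂ)) h1
    simp only [← integral_complex_ofReal, Complex.ofReal_exp, Complex.ofReal_mul] at h2
    simpa using h2
  refine congrFun (AnalyticOnNhd.eq_of_frequently_eq (z₀ := 1)
    (fun z _ => hdiff.analyticAt z) (fun z _ => hdiff'.analyticAt z) ?_) θ
  -- The points 1 + 1/(n+1) lie in [1, ∞) and accumulate at 1, as the identity theorem requires.
  have htend : Filter.Tendsto (fun n : ℕ => (((1 + 1 / ((n : ℝ) + 1) : ℝ)) : ℂ)) Filter.atTop
      (nhdsWithin 1 {1}ᶜ) := by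
    refine tendsto_nhdsWithin_iff.2 ⟨?_, Filter.Eventually.of_forall fun n => ?_⟩
    · have := (tendsto_one_div_add_atTop_nhds_zero_nat (𝕜 := ℝ)).const_add 1
      rw [add_zero] at this
      exact_mod_cast (Complex.continuous_ofReal.tendsto 1).comp this
    · have : (1 + 1 / ((n : ℝ) + 1) : ℝ) ≠ 1 := by
        have : 0 < 1 / ((n : ℝ) + 1) := by positivity
        linarith
      exact fun h => this (Complex.ofReal_eq_one.1 h)
  exact htend.frequently (Filter.Frequently.of_forall fun n =>
    hon _ (by have : 0 < 1 / ((n : ℝ) + 1) := by positivity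
              linarith))

end Analytic

/-! ### The number of users in a fixed set of finite area -/

lemma exists_forall_le_of_iSup_two_pow_ne_top {a : ℕ → ℕ}
    (hfin : ⨆ n, (2 : ℝ≥0∞) ^ a n ≠ ∞) : ∃ n₀, ∀ n, a n ≤ a n₀ := by
  obtain ⟨M, hM⟩ := ENNReal.exists_nat_gt hfin
  have hb (n : ℕ) : a n ≤ M := by
    have h1 : (2 : ℝ≥0∞) ^ a n < M := (le_iSup (fun n => (2 : ℝ≥0∞) ^ a n) n).trans_lt hM
    have h2 : 2 ^ a n < M := by exact_mod_cast h1
    exact (Nat.lt_two_pow_self.trans h2).le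
  obtain ⟨n₀, hn₀⟩ := Nat.sSup_mem (range_nonempty a) ⟨M, forall_mem_range.2 hb⟩
  exact ⟨n₀, fun n => hn₀ ▸ le_csSup ⟨M, forall_mem_range.2 hb⟩ (mem_range_self n)⟩

section Count

variable {Ω : Type*} {Z : ℕ → Ω → Plane} {K : ℕ → Ω → ℕ} {S : ℕ → ℕ → Ω → Plane}

open Classical in
/-- The number of points in `B` of the first `n` clusters. -/
noncomputable def clusterCount (Z : ℕ → Ω → Plane) (K : ℕ → Ω → ℕ) (S : ℕ → ℕ → Ω → Plane)
    (B : Set Plane) (n : ℕ) (ω : Ω) : ℕ :=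
  ∑ i ∈ Finset.range n, ∑ j ∈ Finset.range (K i ω), if Z i ω + S i j ω ∈ B then 1 else 0

lemma clusterProcess_apply {B : Set Plane} (hB : MeasurableSet B) (ω : Ω) :
    clusterProcess Z K S ω B =
      ∑' i, ∑ j ∈ Finset.range (K i ω), B.indicator 1 (Z i ω + S i j ω) := by
  rw [clusterProcess, Measure.sum_apply _ hB]
  refine tsum_congr fun i => ?_
  rw [Measure.finsetSum_apply]
  exact Finset.sum_congr rfl fun j _ => Measure.dirac_apply' _ hB

lemma clusterProcess_apply_eq_iSup {B : Set Plane} (hB : MeasurableSet B) (ω : Ω) :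
    clusterProcess Z K S ω B = ⨆ n, (clusterCount Z K S B n ω : ℝ≥0∞) := by
  rw [clusterProcess_apply hB, ENNReal.tsum_eq_iSup_nat]
  refine iSup_congr fun n => ?_
  rw [clusterCount, Nat.cast_sum]
  refine Finset.sum_congr rfl fun i _ => ?_
  rw [Nat.cast_sum]
  refine Finset.sum_congr rfl fun j _ => ?_
  by_cases hZ : Z i ω + S i j ω ∈ B <;> simp [hZ]

variable [MeasurableSpace Ω] {P : Measure Ω} {lamP mbar : ℝ≥0} {f : Plane → ℝ}

lemma measurable_clusterProcess (h : IsPoissonClusterModel P lamP mbar f Z K S) :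
    Measurable (clusterProcess Z K S) := by
  refine Measure.measurable_of_measurable_coe _ fun B hB => ?_
  simp_rw [clusterProcess_apply hB]
  refine Measurable.tsum fun i => ?_
  refine Measurable.eval_nat
    (g := fun m ω => ∑ j ∈ Finset.range m, B.indicator 1 (Z i ω + S i j ω)) (fun m => ?_)
    (h.measurable_number i)
  exact Finset.measurable_sum _ fun j _ => (measurable_one.indicator hB).comp
    ((h.measurable_parent i).add (h.measurable_displacement i j))

/-- By Tonelli and translation invariance of Lebesgue measure, the integral over z equals the area
of `B`. -/
lemma integrable_measureReal_add_mem [IsProbabilityMeasure (offspringLaw f)] {B : Set Plane}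
    (hB : MeasurableSet B) (hB_fin : volume B ≠ ∞) :
    Integrable fun z => (offspringLaw f).real {s | z + s ∈ B} := by
  have hm : MeasurableSet {p : Plane × Plane | p.1 + p.2 ∈ B} :=
    (measurable_fst.add measurable_snd) hB
  refine integrable_toReal_of_lintegral_ne_top
    (measurable_measure_prodMk_left (ν := offspringLaw f) hm).aemeasurable ?_
  have h1 := Measure.prod_apply (μ := volume) (ν := offspringLaw f) hm
  have h2 := Measure.prod_apply_symm (μ := volume) (ν := offspringLaw f) hm
  refine ne_of_eq_of_ne (h1.symm.trans h2) ?_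
  have h3 (y : Plane) : volume ((fun x => (x, y)) ⁻¹' {p : Plane × Plane | p.1 + p.2 ∈ B}) =
      volume B := measure_preimage_add_right volume y B
  rw [lintegral_congr h3]
  simpa using hB_fin

/-- The generating functional at `k` = t · 1_B: each point in `B` contributes a factor 1 + t, every
other point a factor 1. -/
lemma lintegral_iSup_pow_clusterCount [IsProbabilityMeasure P]
    (h : IsPoissonClusterModel P lamP mbar f Z K S)
    [IsProbabilityMeasure (offspringLaw f)] {B : Set Plane} (hB : MeasurableSet B)
    (hB_fin : volume B ≠ ∞) {t : ℝ} (ht : 0 ≤ t) :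
    ∫⁻ ω, ⨆ n, ENNReal.ofReal (1 + t) ^ clusterCount Z K S B n ω ∂P =
      ENNReal.ofReal (Real.exp (lamP *
        ∫ z, (Real.exp (t * (mbar * (offspringLaw f).real {s | z + s ∈ B})) - 1))) := by
  have hmB (z : Plane) : MeasurableSet {s | z + s ∈ B} := (measurable_const_add z) hB
  have hk : Measurable (B.indicator fun _ => ENNReal.ofReal t) := measurable_const.indicator hB
  have hF (z : Plane) : ∫⁻ s, B.indicator (fun _ => ENNReal.ofReal t) (z + s) ∂offspringLaw f =
      ENNReal.ofReal (t * (offspringLaw f).real {s | z + s ∈ B}) := by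
    rw [ENNReal.ofReal_mul ht, ofReal_measureReal, ← lintegral_indicator_const (hmB z)]
    rfl
  have hmain := lintegral_iSup_prod_cluster h hk (fun z => by simp [hF])
    (by simpa [lintegral_indicator_const hB] using ENNReal.mul_ne_top ENNReal.ofReal_ne_top hB_fin)
  have hH (z : Plane) : eexp (mbar * ∫⁻ s, B.indicator (fun _ => ENNReal.ofReal t) (z + s)
      ∂offspringLaw f) - 1 =
      ENNReal.ofReal (Real.exp (t * (mbar * (offspringLaw f).real {s | z + s ∈ B})) - 1) := by
    rw [hF, ← ENNReal.ofReal_coe_nnreal, ← ENNReal.ofReal_mul (by positivity),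
      eexp_ofReal (by positivity), ENNReal.ofReal_sub _ (by norm_num), ENNReal.ofReal_one]
    ring_nf
  have hint : Integrable fun z =>
      Real.exp (t * (mbar * (offspringLaw f).real {s | z + s ∈ B})) - 1 := by
    have := (integrable_cexp_mul_sub_one
      ((integrable_measureReal_add_mem (f := f) hB hB_fin).const_mul (mbar : ℝ)) (C := mbar)
      (fun z => by positivity)
      (fun z => mul_le_of_le_one_right (by positivity) measureReal_le_one) t).re
    refine this.congr (Filter.Eventually.of_forall fun z => ?_)
    simp only [← Complex.ofReal_mul, ← Complex.ofReal_exp, ← Complex.ofReal_one,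
      ← Complex.ofReal_sub, RCLike.re_eq_complex_re, Complex.ofReal_re]
  have hnonneg (z : Plane) :
      0 ≤ Real.exp (t * (mbar * (offspringLaw f).real {s | z + s ∈ B})) - 1 :=
    sub_nonneg.2 (Real.one_le_exp (by positivity))
  simp_rw [hH] at hmain
  rw [← ofReal_integral_eq_lintegral_ofReal hint (Filter.Eventually.of_forall hnonneg),
    ← ENNReal.ofReal_coe_nnreal, ← ENNReal.ofReal_mul (by positivity),
    eexp_ofReal (mul_nonneg (by positivity) (integral_nonneg hnonneg))] at hmain
  rw [← hmain]
  refine lintegral_congr fun ω => iSup_congr fun n => ?_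
  rw [clusterCount, ← Finset.prod_pow_eq_pow_sum]
  refine Finset.prod_congr rfl fun i _ => ?_
  rw [← Finset.prod_pow_eq_pow_sum]
  refine Finset.prod_congr rfl fun j _ => ?_
  by_cases hZ : Z i ω + S i j ω ∈ B
  · simp [hZ, ENNReal.ofReal_add zero_le_one ht]
  · simp [hZ]

/-- The number of points of a Poisson cluster process in a bounded set is almost surely finite. -/
theorem ae_clusterProcess_eq_natCast [IsProbabilityMeasure P]
    (h : IsPoissonClusterModel P lamP mbar f Z K S)
    [IsProbabilityMeasure (offspringLaw f)] {B : Set Plane} (hB : MeasurableSet B)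
    (hB_fin : volume B ≠ ∞) :
    ∀ᵐ ω ∂P, clusterProcess Z K S ω B = ⌊(clusterProcess Z K S ω B).toReal⌋₊ ∧
      ∀ x : ℝ≥0∞, 1 ≤ x →
        ⨆ n, x ^ clusterCount Z K S B n ω = x ^ ⌊(clusterProcess Z K S ω B).toReal⌋₊ := by
  have hmeas (n : ℕ) : Measurable (clusterCount Z K S B n) := by
    classical
    refine Finset.measurable_sum _ fun i _ => ?_
    refine Measurable.eval_nat
      (g := fun m ω => ∑ j ∈ Finset.range m, if Z i ω + S i j ω ∈ B then 1 else 0) (fun m => ?_)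
      (h.measurable_number i)
    exact Finset.measurable_sum _ fun j _ => Measurable.ite
      (((h.measurable_parent i).add (h.measurable_displacement i j)) hB)
      measurable_const measurable_const
  -- At t = 1 the formula bounds the mean of the supremum of 2^(count). Hence almost surely the
  -- counts are bounded, so this increasing integer sequence attains its supremum.
  have h2 := lintegral_iSup_pow_clusterCount h hB hB_fin zero_le_one
  have hae := ae_lt_top (μ := P)
    (Measurable.iSup fun n =>
      (measurable_of_countable fun m : ℕ => ENNReal.ofReal (1 + 1) ^ m).comp (hmeas n))
    (ne_of_eq_of_ne h2 ENNReal.ofReal_ne_top)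
  filter_upwards [hae] with ω hω
  have htwo : ENNReal.ofReal (1 + 1) = 2 := by norm_num
  obtain ⟨n₀, hn₀⟩ := exists_forall_le_of_iSup_two_pow_ne_top
    (a := fun n => clusterCount Z K S B n ω) (by rw [← htwo]; exact hω.ne)
  have heq : clusterProcess Z K S ω B = clusterCount Z K S B n₀ ω := by
    rw [clusterProcess_apply_eq_iSup hB]
    exact le_antisymm (iSup_le fun n => by exact_mod_cast hn₀ n)
      (le_iSup (fun n => (clusterCount Z K S B n ω : ℝ≥0∞)) n₀)
  have hfloor : ⌊(clusterProcess Z K S ω B).toReal⌋₊ = clusterCount Z K S B n₀ ω := by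
    rw [heq]; simp
  rw [hfloor]
  exact ⟨heq, fun x hx => le_antisymm (iSup_le fun n => pow_le_pow_right₀ hx (hn₀ n))
    (le_iSup (fun n => x ^ clusterCount Z K S B n ω) n₀)⟩

/-- The probability generating function of the number of points of a Poisson cluster process in a
set of finite area. -/
theorem integral_pow_clusterProcess [IsProbabilityMeasure P]
    (h : IsPoissonClusterModel P lamP mbar f Z K S)
    [IsProbabilityMeasure (offspringLaw f)] {B : Set Plane} (hB : MeasurableSet B)
    (hB_fin : volume B ≠ ∞) (θ : ℂ) :
    Integrable (fun ω => θ ^ ⌊(clusterProcess Z K S ω B).toReal⌋₊) P ∧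
      ∫ ω, θ ^ ⌊(clusterProcess Z K S ω B).toReal⌋₊ ∂P =
        Complex.exp (lamP * ∫ z, (Complex.exp
          ((θ - 1) * ((mbar * (offspringLaw f).real {s | z + s ∈ B} : ℝ) : ℂ)) - 1)) := by
  refine integral_pow_eq_cexp (C := mbar)
    (Nat.measurable_floor.comp
      ((Measure.measurable_coe hB).comp (measurable_clusterProcess h)).ennreal_toReal)
    ((integrable_measureReal_add_mem hB hB_fin).const_mul (mbar : ℝ))
    (fun z => by positivity)
    (fun z => mul_le_of_le_one_right (by positivity) measureReal_le_one) lamP (fun t ht => ?_) θ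
  rw [← lintegral_iSup_pow_clusterCount h hB hB_fin ht]
  refine lintegral_congr_ae ?_
  filter_upwards [ae_clusterProcess_eq_natCast h hB hB_fin] with ω hω
  rw [hω.2 _ (by simpa using ht), ENNReal.ofReal_pow (by positivity)]
  rfl

end Count

/-! ### The distance law, isotropy and polar coordinates -/

section Distance

variable {f : Plane → ℝ}

lemma isProbabilityMeasure_offspringLaw (hf_one : ∫⁻ s, ENNReal.ofReal (f s) = 1) :
    IsProbabilityMeasure (offspringLaw f) :=
  ⟨by rw [offspringLaw, withDensity_apply _ MeasurableSet.univ, Measure.restrict_univ, hf_one]⟩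

lemma map_offspringLaw_of_isometry (hf_iso : ∀ s t : Plane, ‖s‖ = ‖t‖ → f s = f t)
    (ρ : Plane ≃ₗᵢ[ℝ] Plane) : (offspringLaw f).map ρ = offspringLaw f := by
  ext A hA
  have hρ : MeasurableEmbedding ρ := ρ.toHomeomorph.measurableEmbedding
  rw [hρ.map_apply, offspringLaw, withDensity_apply _ hA,
    withDensity_apply _ (hρ.measurable hA),
    ← ρ.measurePreserving.setLIntegral_comp_preimage_emb hρ (fun s => ENNReal.ofReal (f s)) A]
  exact lintegral_congr fun s => by rw [hf_iso (ρ s) s (ρ.norm_map s)]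

lemma measurable_norm_add (z : Plane) : Measurable fun s : Plane => ‖z + s‖ :=
  measurable_norm.comp (measurable_const_add z)

lemma distanceLaw_congr (hf_iso : ∀ s t : Plane, ‖s‖ = ‖t‖ → f s = f t)
    {z w : Plane} (hzw : ‖z‖ = ‖w‖) : distanceLaw f z = distanceLaw f w := by
  -- The reflection in the hyperplane orthogonal to z - w; it preserves norms and the isotropic
  -- offspring law.
  obtain ⟨ρ, hρ⟩ : ∃ ρ : Plane ≃ₗᵢ[ℝ] Plane, ρ z = w :=
    ⟨_, Submodule.reflection_sub hzw⟩
  rw [distanceLaw, distanceLaw, ← map_offspringLaw_of_isometry hf_iso ρ,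
    Measure.map_map (measurable_norm_add w) ρ.continuous.measurable]
  rw [map_offspringLaw_of_isometry hf_iso ρ]
  congr 1
  ext s
  simp only [Function.comp_apply]
  rw [← hρ, ← map_add, ρ.norm_map]

/-- In polar coordinates the area of the preimage is a multiple of the integral of y over the null
set. -/
lemma volume_norm_preimage_eq_zero {A : Set ℝ} (hA : volume A = 0) :
    volume ((fun s : Plane => ‖s‖) ⁻¹' A) = 0 := by
  obtain ⟨A', hAA', hA'm, hA'⟩ := exists_measurable_superset_of_null hA
  refine measure_mono_null (preimage_mono hAA') ?_
  have hind : (fun s : Plane => A'.indicator (fun _ => (1 : ℝ)) ‖s‖) =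
      ((fun s : Plane => ‖s‖) ⁻¹' A').indicator 1 := rfl
  have hzero : (fun y : ℝ => y ^ (Module.finrank ℝ Plane - 1) • A'.indicator (fun _ => (1 : ℝ)) y)
      =ᵐ[volume.restrict (Ioi 0)] 0 := by
    filter_upwards [ae_restrict_of_ae (measure_eq_zero_iff_ae_notMem.1 hA')] with y hy
    simp [hy]
  -- Integrability has to be shown too: it excludes infinite area, for which the real-valued measure
  -- would also be 0.
  have hi := (integrable_fun_norm_addHaar (volume : Measure Plane)
    (f := A'.indicator fun _ => (1 : ℝ))).2 ((integrable_congr hzero).2 (integrable_zero _ _ _))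
  have hI := integral_fun_norm_addHaar (volume : Measure Plane) (A'.indicator fun _ => (1 : ℝ))
  rw [integral_congr_ae hzero, hind, integral_indicator_one (measurable_norm hA'm)] at hI
  rw [hind, integrable_indicator_iff (measurable_norm hA'm)] at hi
  have hfin := integrableOn_const_iff (C := (1 : ℝ)) |>.1 hi
  simp only [one_ne_zero, enorm_eq_zero, false_or] at hfin
  simpa [measureReal_eq_zero_iff hfin.ne] using hI

lemma distanceLaw_absolutelyContinuous (z : Plane) : distanceLaw f z ≪ volume := by
  refine Measure.AbsolutelyContinuous.mk fun A hA hA0 => ?_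
  rw [distanceLaw, Measure.map_apply (measurable_norm_add z) hA]
  refine withDensity_absolutelyContinuous _ _ ?_
  exact (measure_preimage_add volume z _).trans (volume_norm_preimage_eq_zero hA0)

lemma norm_plane_fst {v : ℝ} (hv : 0 ≤ v) : ‖(!₂[v, 0] : Plane)‖ = v := by
  simp [EuclideanSpace.norm_eq, Real.sqrt_sq hv]

instance [IsProbabilityMeasure (offspringLaw f)] (z : Plane) :
    IsProbabilityMeasure (distanceLaw f z) :=
  Measure.isProbabilityMeasure_map (measurable_norm_add z).aemeasurable

/-- The distance of an offspring point has the density `fd`. -/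
theorem distanceLaw_eq_withDensity [IsProbabilityMeasure (offspringLaw f)]
    (hf_iso : ∀ s t : Plane, ‖s‖ = ‖t‖ → f s = f t) (z : Plane) :
    distanceLaw f z = volume.withDensity (fun u => ENNReal.ofReal (fd f u ‖z‖)) := by
  rw [distanceLaw_congr hf_iso (norm_plane_fst (norm_nonneg z)).symm]
  conv_lhs => rw [← Measure.withDensity_rnDeriv_eq _ _
    (distanceLaw_absolutelyContinuous (f := f) !₂[‖z‖, 0])]
  refine withDensity_congr_ae ?_
  filter_upwards [Measure.rnDeriv_lt_top (distanceLaw f !₂[‖z‖, 0]) volume] with u hu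
  rw [fd, ENNReal.ofReal_toReal hu.ne]

/-- The probability that an offspring point of a cluster centred at distance `v` from the origin
is at distance less than `r` from the origin. -/
noncomputable def discProb (f : Plane → ℝ) (r v : ℝ) : ℝ := (distanceLaw f !₂[v, 0]).real (Iio r)

lemma discProb_norm (hf_iso : ∀ s t : Plane, ‖s‖ = ‖t‖ → f s = f t) (r : ℝ) (z : Plane) :
    (offspringLaw f).real {s | z + s ∈ Metric.ball 0 r} = discProb f r ‖z‖ := by
  rw [discProb, ← distanceLaw_congr hf_iso (norm_plane_fst (norm_nonneg z)).symm, distanceLaw,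
    map_measureReal_apply (measurable_norm_add z) measurableSet_Iio]
  simp [preimage]

lemma intervalIntegral_fd [IsProbabilityMeasure (offspringLaw f)] {r : ℝ} (hr : 0 ≤ r) (v : ℝ) :
    ∫ u in (0 : ℝ)..r, fd f u v = discProb f r v := by
  have hac := distanceLaw_absolutelyContinuous (f := f) !₂[v, 0]
  rw [intervalIntegral.integral_of_le hr]
  simp only [fd]
  -- The intervals (0, r] and [0, r) differ by a null set for the distance law, and [0, r) may be
  -- replaced by (-∞, r) because norms are nonnegative.
  rw [Measure.setIntegral_toReal_rnDeriv hac, discProb, measureReal_def, measureReal_def,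
    measure_congr (hac.ae_eq Ioc_ae_eq_Icc),
    ← measure_congr (hac.ae_eq Ico_ae_eq_Icc), distanceLaw,
    Measure.map_apply (measurable_norm_add _) measurableSet_Ico,
    Measure.map_apply (measurable_norm_add _) measurableSet_Iio]
  congr 2
  ext s
  simp

lemma parentIntegrand_eq [IsProbabilityMeasure (offspringLaw f)] (mbar : ℝ≥0) (θ : ℂ) {r : ℝ}
    (hr : 0 ≤ r) (v : ℝ) :
    parentIntegrand mbar f θ r v =
      -(v • (Complex.exp ((θ - 1) * ((mbar * discProb f r v : ℝ) : ℂ)) - 1)) := by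
  rw [parentIntegrand, intervalIntegral.integral_const_mul, intervalIntegral.integral_ofReal,
    intervalIntegral_fd hr, Complex.real_smul,
    show -(mbar : ℂ) * ((1 - θ) * (discProb f r v : ℂ)) =
      (θ - 1) * ((mbar * discProb f r v : ℝ) : ℂ) by push_cast; ring]
  ring

lemma finrank_plane_sub_one : Module.finrank ℝ Plane - 1 = 1 := by simp

lemma integrable_cexp_discProb [IsProbabilityMeasure (offspringLaw f)]
    (hf_iso : ∀ s t : Plane, ‖s‖ = ‖t‖ → f s = f t) (mbar : ℝ≥0) (θ : ℂ) (r : ℝ) :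
    Integrable fun z : Plane =>
      Complex.exp ((θ - 1) * ((mbar * discProb f r ‖z‖ : ℝ) : ℂ)) - 1 := by
  simp_rw [← discProb_norm hf_iso]
  exact integrable_cexp_mul_sub_one (C := mbar)
    ((integrable_measureReal_add_mem Metric.isOpen_ball.measurableSet
      measure_ball_lt_top.ne).const_mul (mbar : ℝ))
    (fun z => by positivity)
    (fun z => mul_le_of_le_one_right (by positivity) measureReal_le_one) _

lemma integrableOn_parentIntegrand [IsProbabilityMeasure (offspringLaw f)]
    (hf_iso : ∀ s t : Plane, ‖s‖ = ‖t‖ → f s = f t) (mbar : ℝ≥0) (θ : ℂ) {r : ℝ} (hr : 0 ≤ r) :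
    IntegrableOn (parentIntegrand mbar f θ r) (Ioi 0) := by
  have h := (integrable_fun_norm_addHaar (volume : Measure Plane)
    (f := fun v => Complex.exp ((θ - 1) * ((mbar * discProb f r v : ℝ) : ℂ)) - 1)).1
    (integrable_cexp_discProb hf_iso mbar θ r)
  simp only [finrank_plane_sub_one, pow_one] at h
  exact h.neg.congr (Filter.Eventually.of_forall fun v => (parentIntegrand_eq mbar θ hr v).symm)

/-- Polar coordinates: the constant is the dimension 2 times the area π of the unit disc, and the
sign comes from `parentIntegrand_eq`. -/
lemma integral_cexp_discProb [IsProbabilityMeasure (offspringLaw f)]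
    (mbar : ℝ≥0) (θ : ℂ) {r : ℝ} (hr : 0 ≤ r) :
    ∫ z : Plane, (Complex.exp ((θ - 1) * ((mbar * discProb f r ‖z‖ : ℝ) : ℂ)) - 1) =
      -2 * (Real.pi : ℂ) * ∫ v in Ioi (0 : ℝ), parentIntegrand mbar f θ r v := by
  have hvol : (volume : Measure Plane).real (Metric.ball 0 1) = Real.pi := by
    simp [measureReal_def, InnerProductSpace.volume_ball_of_dim_even (k := 1), Real.pi_nonneg]
  have h := integral_fun_norm_addHaar (volume : Measure Plane)
    fun v => Complex.exp ((θ - 1) * ((mbar * discProb f r v : ℝ) : ℂ)) - 1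
  rw [h, hvol]
  simp_rw [parentIntegrand_eq mbar θ hr, finrank_plane_sub_one, pow_one, integral_neg]
  simp [mul_assoc]

end Distance

/-! ### The law of the radius: from Gamma to Nakagami -/

/-- Change of variables for densities on the positive half-line. -/
lemma map_withDensity_Ioi {φ φ' T : ℝ → ℝ} (hT : Measurable T)
    (hφ : ∀ x ∈ Ioi (0 : ℝ), HasDerivWithinAt φ (φ' x) (Ioi 0) x) (hinv : ∀ x, 0 < x → T (φ x) = x)
    (himg : φ '' Ioi 0 = Ioi 0) (g : ℝ → ℝ≥0∞) :
    ((volume.restrict (Ioi 0)).withDensity g).map T =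
      (volume.restrict (Ioi 0)).withDensity fun x => ENNReal.ofReal |φ' x| * g (φ x) := by
  ext A hA
  have hinj : InjOn φ (Ioi 0) := fun x hx y hy hxy => by
    rw [← hinv x hx, hxy, hinv y hy]
  rw [Measure.map_apply hT hA, withDensity_apply _ (hT hA), withDensity_apply _ hA,
    ← lintegral_indicator (hT hA), ← lintegral_indicator hA]
  conv_lhs => rw [← himg]
  rw [lintegral_image_eq_lintegral_abs_deriv_mul measurableSet_Ioi hφ hinj]
  refine setLIntegral_congr_fun measurableSet_Ioi fun x hx => ?_
  by_cases hxA : x ∈ A <;> simp [indicator, hinv x hx, hxA]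

lemma gammaMeasure_eq_restrict (a r : ℝ) :
    gammaMeasure a r = (volume.restrict (Ioi 0)).withDensity (gammaPDF a r) := by
  rw [gammaMeasure, ← withDensity_indicator measurableSet_Ioi]
  refine withDensity_congr_ae ?_
  -- The point 0, where the density formula applies but `Ioi 0` does not reach, is a null set.
  filter_upwards [Measure.ae_ne volume (0 : ℝ)] with x hx
  rcases hx.lt_or_gt with h | h
  · simp [gammaPDF_of_neg h, h.le]
  · simp [h]

lemma map_sqrt_gammaMeasure :
    (gammaMeasure 3.5 3.5).map (fun x => √x) =
      (volume.restrict (Ioi 0)).withDensity (fun x => ENNReal.ofReal (nakagamiPDF x)) := by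
  rw [gammaMeasure_eq_restrict, map_withDensity_Ioi (φ := fun x => x ^ 2) (φ' := fun x => 2 * x)
    Real.continuous_sqrt.measurable]
  · refine withDensity_congr_ae ((ae_restrict_iff' measurableSet_Ioi).2
      (Filter.Eventually.of_forall fun x hx => ?_))
    have hx : 0 < x := hx
    beta_reduce
    rw [gammaPDF_of_nonneg (by positivity), ← ENNReal.ofReal_mul (by positivity), nakagamiPDF,
      abs_of_pos (by positivity)]
    congr 1
    -- The Jacobian 2x supplies the remaining factor of x ^ 6.
    have : (x ^ 2) ^ ((3.5 : ℝ) - 1) = x ^ 5 := by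
      rw [← Real.rpow_natCast, ← Real.rpow_mul hx.le, ← Real.rpow_natCast]
      norm_num
    rw [this]
    ring_nf
  · intro x _
    simpa using (hasDerivAt_pow 2 x).hasDerivWithinAt
  · exact fun x hx => Real.sqrt_sq hx.le
  · ext y
    refine ⟨?_, fun hy => ⟨√y, Real.sqrt_pos.2 hy, Real.sq_sqrt (le_of_lt hy)⟩⟩
    rintro ⟨x, hx, rfl⟩
    exact pow_pos (mem_Ioi.1 hx) 2

lemma map_div_nakagami {c : ℝ} (hc : 0 < c) :
    ((volume.restrict (Ioi 0)).withDensity (fun x => ENNReal.ofReal (nakagamiPDF x))).map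
      (fun x => x / c) =
      (volume.restrict (Ioi 0)).withDensity (fun x => ENNReal.ofReal (c * nakagamiPDF (c * x))) := by
  have hT : Measurable fun x : ℝ => x / c := measurable_id.div_const c
  rw [map_withDensity_Ioi (φ := fun x => c * x) (φ' := fun _ => c) hT]
  · simp_rw [abs_of_pos hc, ENNReal.ofReal_mul hc.le]
  · intro x _
    simpa using ((hasDerivAt_id x).const_mul c).hasDerivWithinAt
  · intro x _
    field_simp
  · ext y
    refine ⟨?_, fun hy => ⟨y / c, div_pos hy hc, by field_simp⟩⟩
    rintro ⟨x, hx, rfl⟩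
    exact mul_pos hc hx

lemma sqrt_mul_discRadius (lamB : ℝ≥0) (a : ℝ) :
    √(Real.pi * lamB) * discRadius a = √(lamB * a) := by
  rw [discRadius, ← Real.sqrt_mul (by positivity)]
  congr 1
  field_simp

section Radius

variable {Ω : Type*} [MeasurableSpace Ω] {P : Measure Ω} {lamB : ℝ≥0} {A : Ω → ℝ}

theorem hasLaw_sqrt_mul_discRadius
    (hA_law : HasLaw (fun ω => (lamB : ℝ) * A ω) (gammaMeasure 3.5 3.5) P) :
    HasLaw (fun ω => √(Real.pi * lamB) * discRadius (A ω))
      ((volume.restrict (Ioi 0)).withDensity (fun x => ENNReal.ofReal (nakagamiPDF x))) P := by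
  simp_rw [sqrt_mul_discRadius]
  exact HasLaw.fun_comp ⟨Real.continuous_sqrt.measurable.aemeasurable, map_sqrt_gammaMeasure⟩ hA_law

theorem hasLaw_discRadius (hlamB : 0 < lamB)
    (hA_law : HasLaw (fun ω => (lamB : ℝ) * A ω) (gammaMeasure 3.5 3.5) P) :
    HasLaw (fun ω => discRadius (A ω))
      ((volume.restrict (Ioi 0)).withDensity (fun r => ENNReal.ofReal (radiusPDF lamB r))) P := by
  have hc : 0 < √(Real.pi * lamB) := Real.sqrt_pos.2 (by positivity)
  have h := HasLaw.fun_comp ⟨(measurable_id.div_const _).aemeasurable, map_div_nakagami hc⟩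
    (hasLaw_sqrt_mul_discRadius hA_law)
  refine h.congr (Filter.Eventually.of_forall fun ω => ?_)
  simp only [id]
  field_simp

end Radius

/-! ### Mixing over the independent random radius -/

/-- An open ball is the increasing union of the balls of smaller rational radius, so its measure is
a countable supremum of functions jointly measurable in radius and measure. -/
lemma measurable_measure_ball :
    Measurable fun p : ℝ × Measure Plane => p.2 (Metric.ball (0 : Plane) p.1) := by
  have h (p : ℝ × Measure Plane) : p.2 (Metric.ball (0 : Plane) p.1) =
      ⨆ q : ℚ, {x : ℝ × Measure Plane | (q : ℝ) < x.1}.indicator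
        (fun x => x.2 (Metric.ball (0 : Plane) q)) p := by
    refine le_antisymm ?_ (iSup_le fun q => ?_)
    · have hball : Metric.ball (0 : Plane) p.1 =
          ⋃ q : {q : ℚ // (q : ℝ) < p.1}, Metric.ball (0 : Plane) (q : ℚ) := by
        ext x
        simp only [Metric.mem_ball, mem_iUnion, Subtype.exists, exists_prop]
        refine ⟨fun hx => ?_, fun ⟨q, hq, hx⟩ => hx.trans hq⟩
        obtain ⟨q, hxq, hq⟩ := exists_rat_btwn hx
        exact ⟨q, hq, hxq⟩
      rw [hball, Monotone.measure_iUnion]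
      · refine iSup_le fun q => le_iSup_of_le q.1 ?_
        rw [indicator_of_mem (show p ∈ {x : ℝ × Measure Plane | (q.1 : ℝ) < x.1} from q.2)]
      · exact fun q q' hqq' => Metric.ball_subset_ball (by exact_mod_cast hqq')
    · refine indicator_apply_le' (fun hq => ?_) (fun _ => zero_le)
      exact measure_mono (Metric.ball_subset_ball (le_of_lt hq))
  simp_rw [h]
  exact Measurable.iSup fun q =>
    ((Measure.measurable_coe Metric.isOpen_ball.measurableSet).comp measurable_snd).indicator
      (measurableSet_lt measurable_const measurable_fst)

lemma measurable_floor_measure_ball :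
    Measurable fun p : ℝ × Measure Plane => ⌊(p.2 (Metric.ball (0 : Plane) p.1)).toReal⌋₊ :=
  Nat.measurable_floor.comp measurable_measure_ball.ennreal_toReal

lemma measurable_discRadius : Measurable discRadius :=
  (measurable_id.div_const Real.pi).sqrt

lemma measurable_radiusPDF (lamB : ℝ≥0) : Measurable (radiusPDF lamB) := by
  unfold radiusPDF nakagamiPDF
  fun_prop

lemma radiusPDF_nonneg (lamB : ℝ≥0) (r : ℝ) : 0 ≤ radiusPDF lamB r := by
  have : 0 < Real.Gamma 3.5 := Real.Gamma_pos_of_pos (by norm_num)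
  have : 0 ≤ (√(Real.pi * lamB) * r) ^ 6 := Even.pow_nonneg (by decide) _
  unfold radiusPDF nakagamiPDF
  positivity

section Mixture

variable {Ω : Type*} [MeasurableSpace Ω] {P : Measure Ω} [IsProbabilityMeasure P]
  {lamP mbar : ℝ≥0} {f : Plane → ℝ} {Z : ℕ → Ω → Plane} {K : ℕ → Ω → ℕ} {S : ℕ → ℕ → Ω → Plane}
  {R : Ω → ℝ}

lemma map_prodMk_clusterProcess (h : IsPoissonClusterModel P lamP mbar f Z K S)
    (hR : Measurable R) (hRΦ : IndepFun R (clusterProcess Z K S) P) :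
    P.map (fun ω => (R ω, clusterProcess Z K S ω)) =
      (P.map R).prod (P.map (clusterProcess Z K S)) :=
  (indepFun_iff_map_prod_eq_prod_map_map hR.aemeasurable
    (measurable_clusterProcess h).aemeasurable).1 hRΦ

/-- The count is almost surely finite for each fixed radius; by independence the joint law is a
product, and Fubini for null sets passes to the random radius. -/
theorem ae_clusterProcess_ball_eq_discLoad (h : IsPoissonClusterModel P lamP mbar f Z K S)
    [IsProbabilityMeasure (offspringLaw f)]
    (hR : Measurable R) (hRΦ : IndepFun R (clusterProcess Z K S) P) :
    ∀ᵐ ω ∂P, clusterProcess Z K S ω (Metric.ball 0 (R ω)) =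
      (discLoad (clusterProcess Z K S) R ω : ℝ≥0∞) := by
  have hΦ := measurable_clusterProcess h
  have hset : MeasurableSet {p : ℝ × Measure Plane | p.2 (Metric.ball (0 : Plane) p.1) =
      (⌊(p.2 (Metric.ball (0 : Plane) p.1)).toReal⌋₊ : ℝ≥0∞)} :=
    measurableSet_eq_fun measurable_measure_ball
      ((measurable_of_countable _).comp measurable_floor_measure_ball)
  have := Measure.isProbabilityMeasure_map (μ := P) hΦ.aemeasurable
  refine (ae_map_iff (hR.prodMk hΦ).aemeasurable hset).1 ?_
  rw [map_prodMk_clusterProcess h hR hRΦ, Measure.ae_prod_iff_ae_ae hset]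
  refine Filter.Eventually.of_forall fun r => ?_
  refine (ae_map_iff hΦ.aemeasurable (measurable_prodMk_left (x := r) hset)).2 ?_
  exact (ae_clusterProcess_eq_natCast h Metric.isOpen_ball.measurableSet
    measure_ball_lt_top.ne).mono fun ω hω => hω.1

/-- Conditioning on the radius of the disc. -/
lemma integral_pow_discLoad (h : IsPoissonClusterModel P lamP mbar f Z K S)
    (hR : Measurable R) (hRΦ : IndepFun R (clusterProcess Z K S) P) (θ : ℂ)
    (hθ : Integrable (fun ω => θ ^ discLoad (clusterProcess Z K S) R ω) P) :
    Integrable (fun r : ℝ => ∫ ω, θ ^ ⌊(clusterProcess Z K S ω (Metric.ball 0 r)).toReal⌋₊ ∂P)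
        (P.map R) ∧
      ∫ ω, θ ^ discLoad (clusterProcess Z K S) R ω ∂P =
        ∫ r, ∫ ω, θ ^ ⌊(clusterProcess Z K S ω (Metric.ball 0 r)).toReal⌋₊ ∂P ∂(P.map R) := by
  have hΦ := measurable_clusterProcess h
  let q : ℝ × Measure Plane → ℂ := fun p => θ ^ ⌊(p.2 (Metric.ball (0 : Plane) p.1)).toReal⌋₊
  have hq : Measurable q :=
    (measurable_of_countable fun n : ℕ => θ ^ n).comp measurable_floor_measure_ball
  have := Measure.isProbabilityMeasure_map (μ := P) hΦ.aemeasurable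
  have := Measure.isProbabilityMeasure_map (μ := P) hR.aemeasurable
  have hint : Integrable q ((P.map R).prod (P.map (clusterProcess Z K S))) := by
    rw [← map_prodMk_clusterProcess h hR hRΦ,
      integrable_map_measure hq.aestronglyMeasurable (hR.prodMk hΦ).aemeasurable]
    exact hθ
  have hinner (r : ℝ) : ∫ ν, q (r, ν) ∂(P.map (clusterProcess Z K S)) =
      ∫ ω, θ ^ ⌊(clusterProcess Z K S ω (Metric.ball 0 r)).toReal⌋₊ ∂P :=
    integral_map hΦ.aemeasurable (hq.comp measurable_prodMk_left).aestronglyMeasurable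
  simp_rw [← hinner]
  refine ⟨hint.integral_prod_left, ?_⟩
  rw [← integral_prod _ hint, ← map_prodMk_clusterProcess h hR hRΦ,
    integral_map (hR.prodMk hΦ).aemeasurable hq.aestronglyMeasurable]
  rfl

lemma integral_pow_ball (h : IsPoissonClusterModel P lamP mbar f Z K S)
    [IsProbabilityMeasure (offspringLaw f)]
    (hf_iso : ∀ s t : Plane, ‖s‖ = ‖t‖ → f s = f t) (θ : ℂ) {r : ℝ} (hr : 0 ≤ r) :
    ∫ ω, θ ^ ⌊(clusterProcess Z K S ω (Metric.ball 0 r)).toReal⌋₊ ∂P =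
      Complex.exp (-2 * (Real.pi : ℂ) * (lamP : ℂ) *
        ∫ v in Ioi (0 : ℝ), parentIntegrand mbar f θ r v) := by
  rw [(integral_pow_clusterProcess h Metric.isOpen_ball.measurableSet
    measure_ball_lt_top.ne θ).2]
  simp_rw [discProb_norm hf_iso]
  rw [integral_cexp_discProb mbar θ hr]
  congr 1
  ring

end Mixture

theorem theorem2 {Ω : Type*} [MeasurableSpace Ω] (P : Measure Ω) [IsProbabilityMeasure P]
    (lamB lamP mbar : ℝ≥0) (hlamB : 0 < lamB) (hlamP : 0 < lamP)
    -- the offspring density, isotropic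
    (f : Plane → ℝ) (hf_meas : Measurable f) (hf_nonneg : ∀ s, 0 ≤ f s)
    (hf_one : ∫⁻ s, ENNReal.ofReal (f s) = 1)
    (hf_iso : ∀ s t : Plane, ‖s‖ = ‖t‖ → f s = f t)
    -- the users: a Poisson cluster process
    (Z : ℕ → Ω → Plane) (K : ℕ → Ω → ℕ) (S : ℕ → ℕ → Ω → Plane)
    (hPCP : IsPoissonClusterModel P lamP mbar f Z K S)
    -- the area of the typical cell, independent of the users
    (A : Ω → ℝ) (hA_meas : Measurable A)
    (hA_law : HasLaw (fun ω => (lamB : ℝ) * A ω) (gammaMeasure 3.5 3.5) P)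
    (hA_indep : IndepFun A (clusterProcess Z K S) P) :
    -- the distance of an offspring point given its cluster centre `z` has the PDF `f_d(·|‖z‖)`
    (∀ z : Plane, distanceLaw f z =
      volume.withDensity (fun u => ENNReal.ofReal (fd f u ‖z‖))) ∧
    -- `√(π λ_b) R_c` is Nakagami distributed, and `R_c` has the PDF `f_{R_c}`
    HasLaw (fun ω => √(Real.pi * lamB) * discRadius (A ω))
      ((volume.restrict (Ioi 0)).withDensity (fun x => ENNReal.ofReal (nakagamiPDF x))) P ∧
    HasLaw (fun ω => discRadius (A ω))
      ((volume.restrict (Ioi 0)).withDensity (fun r => ENNReal.ofReal (radiusPDF lamB r))) P ∧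
    -- the load is almost surely finite
    (∀ᵐ ω ∂P, clusterProcess Z K S ω (Metric.ball 0 (discRadius (A ω))) =
      (discLoad (clusterProcess Z K S) (fun ω' => discRadius (A ω')) ω : ℝ≥0∞)) ∧
    -- the PGF exists on the closed unit disc, and wherever it exists it is given by the formula
    ∀ θ : ℂ,
      (‖θ‖ ≤ 1 → Integrable
        (fun ω => θ ^ discLoad (clusterProcess Z K S) (fun ω' => discRadius (A ω')) ω) P) ∧
      (∀ r : ℝ, 0 < r → IntegrableOn (parentIntegrand mbar f θ r) (Ioi 0)) ∧
      (Integrable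
          (fun ω => θ ^ discLoad (clusterProcess Z K S) (fun ω' => discRadius (A ω')) ω) P →
        IntegrableOn (loadIntegrand lamB lamP mbar f θ) (Ioi 0) ∧
        ∫ ω, θ ^ discLoad (clusterProcess Z K S) (fun ω' => discRadius (A ω')) ω ∂P =
          ∫ r in Ioi (0 : ℝ), loadIntegrand lamB lamP mbar f θ r) := by
  have : IsProbabilityMeasure (offspringLaw f) := isProbabilityMeasure_offspringLaw hf_one
  have hR : Measurable fun ω => discRadius (A ω) := measurable_discRadius.comp hA_meas
  have hRΦ : IndepFun (fun ω => discRadius (A ω)) (clusterProcess Z K S) P :=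
    hA_indep.comp measurable_discRadius measurable_id
  have hlaw := hasLaw_discRadius hlamB hA_law
  have hload := ae_clusterProcess_ball_eq_discLoad hPCP hR hRΦ
  refine ⟨distanceLaw_eq_withDensity hf_iso, hasLaw_sqrt_mul_discRadius hA_law, hlaw, hload,
    fun θ => ⟨fun hθ => ?_, fun r hr => integrableOn_parentIntegrand hf_iso mbar θ hr.le,
      fun hθ => ?_⟩⟩
  · refine Integrable.of_bound (C := 1) ?_ (Filter.Eventually.of_forall fun ω => ?_)
    · exact ((measurable_of_countable fun n : ℕ => θ ^ n).comp
        (measurable_floor_measure_ball.comp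
          (hR.prodMk (measurable_clusterProcess hPCP)))).aestronglyMeasurable
    · rw [norm_pow]
      exact pow_le_one₀ (norm_nonneg θ) hθ
  · obtain ⟨hint, heq⟩ := integral_pow_discLoad hPCP hR hRΦ θ hθ
    have hpdf : Measurable fun r => ENNReal.ofReal (radiusPDF lamB r) :=
      (measurable_radiusPDF lamB).ennreal_ofReal
    have hpdf_top : ∀ᵐ r ∂volume.restrict (Ioi (0 : ℝ)), ENNReal.ofReal (radiusPDF lamB r) < ∞ :=
      Filter.Eventually.of_forall fun r => ENNReal.ofReal_lt_top
    -- The formula for a fixed radius, weighted by the density of the radius, is exactly the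
    -- integrand claimed.
    have hcongr : (fun r : ℝ => (ENNReal.ofReal (radiusPDF lamB r)).toReal •
        ∫ ω, θ ^ ⌊(clusterProcess Z K S ω (Metric.ball 0 r)).toReal⌋₊ ∂P)
        =ᵐ[volume.restrict (Ioi 0)] loadIntegrand lamB lamP mbar f θ := by
      refine (ae_restrict_iff' measurableSet_Ioi).2 (Filter.Eventually.of_forall fun r hr => ?_)
      beta_reduce
      rw [ENNReal.toReal_ofReal (radiusPDF_nonneg lamB r),
        integral_pow_ball hPCP hf_iso θ (le_of_lt hr), loadIntegrand, Complex.real_smul, mul_comm]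
    rw [hlaw.map_eq] at hint heq
    rw [integrable_withDensity_iff_integrable_smul' hpdf hpdf_top] at hint
    rw [integral_withDensity_eq_integral_toReal_smul hpdf hpdf_top] at heq
    exact ⟨hint.congr hcongr, heq.trans (integral_congr_ae hcongr)⟩
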